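/- Let $k\ge 2$ and $n\ge 1$. In the $k$-party unique-disjointness problem $k\text{-}\mathrm{UDISJ}$ on $[n]$, party $j\in[k]$ holds a string $x_j\in\{0,1\}^n$ (the indicator vector of a subset of $[n]$). It is promised that $x=(x_1,\dots,x_k)$ lies in $D_0\cup D_*$, where \[ D_0=\{x:\ \forall i\in[n],\ x_1(i)+\dots+x_k(i)\le 1\}, \] \[ D_*=\{x:\ \exists \ell\in[n],\ x_1(\ell)=\dots=x_k(\ell)=1\ \text{ and }\ \forall i\ne \ell,\ x_1(i)+\dots+x_k(i)\le 1\}, \] and the parties must output $0$ if $x\in D_0$ and $1$ if $x\in D_*$. A deterministic protocol is a finite binary tree: at each internal node a party determined by the node writes on a shared blackboard one bit depending only on its own input, and each leaf is labelled with an output bit; its cost is the depth of the tree. A randomized (public-coin) protocol is a probability distribution on deterministic protocols; its cost is the largest cost of a protocol in the support, and it has error at most $\varepsilon$ if on every fixed $x\in D_0\cup D_*$ its output is wrong with probability at most $\varepsilon$. Let $R_\varepsilon(k\text{-}\mathrm{UDISJ}_n)$ be the minimum cost of a randomized protocol for this problem with error at most $\varepsilon$. **Theorem.** For every constant $\varepsilon\in[0,1/2)$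 there is a constant $c>0$, depending only on $\varepsilon$, such that for all $k\ge 2$ and $n\ge 1$, \[ R_\varepsilon(k\text{-}\mathrm{UDISJ}_n)\ \ge\ c\cdot\frac{n}{k}. \] That is, the randomized bounded-error communication complexity of $k\text{-}\mathrm{UDISJ}$ is $\Omega(n/k)$. -/

import Mathlib

/-- Deterministic `k`-party number-in-hand protocol trees (shared blackboard), where each party
holds an input in `X`. At an internal node the speaker `j`, which is fixed by the bits written so
far, writes the bit `msg (x j)` computed from its own input, visible to everybody; a leaf carries
the output. -/
inductive Protocol (k : ℕ) (X : Type) : Type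
  | leaf (out : Bool) : Protocol k X
  | node (j : Fin k) (msg : X → Bool) (next : Bool → Protocol k X) : Protocol k X

namespace Protocol

variable {k : ℕ} {X : Type}

/-- The output of the protocol on the input `x`, where party `j` holds `x j`. -/
def run : Protocol k X → (Fin k → X) → Bool
  | leaf out, _ => out
  | node j msg next, x => run (next (msg (x j))) x

/-- The communication cost: the largest number of bits written on a root-to-leaf path. -/
def cost : Protocol k X → ℕ
  | leaf _ => 0
  | node _ _ next => 1 + max (cost (next false)) (cost (next true))

end Protocol

/-- The public-coin randomized protocol `μ` (a probability distribution on deterministic protocols)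
computes with error at most `ε`, on every input of the promise, the partial Boolean function whose
no instances are `D₀` and whose yes instances are `D₁`. -/
def ComputesWithError {k : ℕ} {X : Type} (μ : PMF (Protocol k X)) (D₀ D₁ : Set (Fin k → X))
    (ε : ℝ) : Prop :=
  (∀ x ∈ D₀, ((μ.map fun π => π.run x) true).toReal ≤ ε) ∧
    (∀ x ∈ D₁, ((μ.map fun π => π.run x) false).toReal ≤ ε)

/-- The numbers `c` such that some public-coin randomized protocol with error at most `ε` never
communicates more than `c` bits, whatever the input and the coins are. -/
def achievableCosts {k : ℕ} {X : Type} (D₀ D₁ : Set (Fin k → X)) (ε : ℝ) : Set ℕ :=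
  {c | ∃ μ : PMF (Protocol k X), (∀ π ∈ μ.support, π.cost ≤ c) ∧ ComputesWithError μ D₀ D₁ ε}

/-- The public-coin randomized communication complexity, with error `ε`, of a partial Boolean
function with no instances `D₀` and yes instances `D₁`. -/
noncomputable def randomizedCC {k : ℕ} {X : Type} (D₀ D₁ : Set (Fin k → X)) (ε : ℝ) : ℕ :=
  sInf (achievableCosts D₀ D₁ ε)

/-- No instances of `k`-party unique-disjointness: the `k` subsets of `[n]`, given by their
indicator vectors, are pairwise disjoint. -/
def udisjNo (k n : ℕ) : Set (Fin k → Fin n → Bool) :=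
  {x | ∀ i, ∑ j, (x j i).toNat ≤ 1}

/-- Yes instances of `k`-party unique-disjointness: some `ℓ` is in all sets, and every other
element is in at most one set. -/
def udisjYes (k n : ℕ) : Set (Fin k → Fin n → Bool) :=
  {x | ∃ ℓ, (∀ j, x j ℓ = true) ∧ ∀ i, i ≠ ℓ → ∑ j, (x j i).toNat ≤ 1}

/-- Any function of the answers to a list of questions to single parties has a protocol. -/
theorem Protocol.exists_run_eq_of_queries {k : ℕ} {X : Type} (L : List (Fin k × (X → Bool))) :
    ∀ g : List Bool → Bool, ∃ π : Protocol k X,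
      ∀ x, π.run x = g (L.map fun q => q.2 (x q.1)) := by
  induction L with
  | nil => exact fun g => ⟨.leaf (g []), fun x => rfl⟩
  | cons q L ih =>
    intro g
    choose next hnext using fun b : Bool => ih fun l => g (b :: l)
    exact ⟨.node q.1 q.2 next, fun x => by simp [Protocol.run, hnext]⟩

/-- The infimum defining `randomizedCC` for unique-disjointness is over a nonempty set, so it is
attained (the yes and no instances are disjoint because there are at least two parties). -/
theorem achievableCosts_udisj_nonempty {k : ℕ} (n : ℕ) (hk : 2 ≤ k) {ε : ℝ} (hε : 0 ≤ ε) :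
    (achievableCosts (udisjNo k n) (udisjYes k n) ε).Nonempty := by
  classical
  let L : List (Fin k × ((Fin n → Bool) → Bool)) :=
    (Finset.univ : Finset (Fin k × Fin n)).toList.map fun p => (p.1, fun y => y p.2)
  let ans : (Fin k → Fin n → Bool) → List Bool := fun x => L.map fun q => q.2 (x q.1)
  have hinj : Function.Injective ans := by
    intro x y hxy
    funext j i
    have h : ∀ q ∈ L, q.2 (x q.1) = q.2 (y q.1) := List.map_inj_left.mp hxy
    exact h (j, fun y => y i) (List.mem_map.mpr ⟨(j, i), by simp, rfl⟩)
  obtain ⟨π, hπ⟩ := Protocol.exists_run_eq_of_queries L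
    (fun l => decide (∃ x, ans x = l ∧ x ∈ udisjYes k n))
  have hrun : ∀ x, π.run x = decide (x ∈ udisjYes k n) := by
    intro x
    rw [hπ]
    refine decide_eq_decide.mpr ⟨?_, fun h => ⟨x, rfl, h⟩⟩
    rintro ⟨y, hy, h⟩
    exact hinj hy ▸ h
  refine ⟨π.cost, PMF.pure π, by simp, fun x hx => ?_, fun x hx => ?_⟩
  · have hx' : x ∉ udisjYes k n := by
      rintro ⟨l, hl, -⟩
      have h1 := hx l
      simp [hl] at h1
      omega
    simpa [PMF.pure_map, hrun, hx'] using hε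
  · simpa [PMF.pure_map, hrun, hx] using hε

/-! Each element `i` gets a uniformly random owner `d i`, who alone may hold it and does so by a
fair coin. Planting a set `A` of parties at `i` turns this base input into a no instance for `A = ∅`
and a yes instance for `A = univ`. So a protocol of error `ε` must, for every `d` and `i`, accept
these two with probabilities differing by at least `1 - 2ε` on average, and their leaf distributions
must be far apart in Hellinger distance.

For small cost they cannot be, for three reasons. Since leaves are rectangles, the leaf
distributions satisfy cut-and-paste (`plantedCount_mul`), so merging parties in pairs bounds the
distance from `∅` to `univ` by `exp 2` times the sum over `j` of the distances from `∅` to `{j}`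
(`sq_norm_sub_univ_le`). The counts at `i` ignore `d i`, so after averaging over `d` that sum is `k`
times the distance for the owner (`card_mul_sum_coord`). Finally, the owner distances measure how
the leaf biases the owners' coins; by the level-one inequality and the entropy bound they sum over
`i` to `O(C)` for cost `C` (`sum_plantedHellinger_le`). Together `(1 - 2ε)² n ≤ O(k C)`. -/

/-! ### Protocols as rectangle partitions. -/

/-- A protocol partitions the inputs into at most `2 ^ cost` combinatorial rectangles, on each of
which its output is constant. -/
theorem Protocol.exists_rectangles {k : ℕ} {X : Type} (π : Protocol k X) :
    ∃ (L : Type) (_ : Fintype L) (R : L → Fin k → Set X) (f : (Fin k → X) → L) (out : L → Bool),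
      Fintype.card L ≤ 2 ^ π.cost ∧ (∀ x l, f x = l ↔ ∀ j, x j ∈ R l j) ∧
        ∀ x, π.run x = out (f x) := by
  induction π with
  | leaf o =>
    exact ⟨Unit, inferInstance, fun _ _ => Set.univ, fun _ => (), fun _ => o,
      by simp [Protocol.cost],
      by simp, by simp [Protocol.run]⟩
  | node j msg next ih =>
    choose L hL R f out hcard hR hrun using ih
    refine ⟨Σ b, L b, inferInstance,
      fun l j' => {y | y ∈ R l.1 l.2 j' ∧ (j' = j → msg y = l.1)},
      fun x => ⟨msg (x j), f _ x⟩, fun l => out l.1 l.2, ?_, ?_, ?_⟩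
    · rw [Fintype.card_sigma, Fintype.sum_bool, Protocol.cost, pow_add, pow_one, two_mul]
      exact add_le_add
        ((hcard true).trans (Nat.pow_le_pow_right (by norm_num) (le_max_right _ _)))
        ((hcard false).trans (Nat.pow_le_pow_right (by norm_num) (le_max_left _ _)))
    · rintro x ⟨b, l⟩
      constructor
      · intro h
        obtain ⟨rfl, h⟩ := Sigma.mk.inj_iff.mp h
        intro j'
        exact ⟨(hR _ x l).mp (eq_of_heq h) j', by rintro rfl; rfl⟩
      · intro h
        have hb : msg (x j) = b := (h j).2 rfl
        subst hb
        exact congrArg (Sigma.mk _) ((hR _ x l).mpr fun j' => (h j').1)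
    · intro x
      simp [Protocol.run, hrun]

/-! ### Level-one inequality and entropy bound. -/

/-- The sign `1` or `-1` of a bit. -/
def bitSign (b : Bool) : ℝ := if b then 1 else -1

/-- The coordinates are independent, so the exponential moment factors, and each factor is
controlled by `cosh t ≤ exp (t² / 2)`. -/
theorem sum_exp_linear_le {ι : Type*} [Fintype ι] [DecidableEq ι] (c : ι → ℝ) :
    ∑ y : ι → Bool, Real.exp (∑ i, c i * bitSign (y i)) ≤
      (Fintype.card (ι → Bool) : ℝ) * Real.exp ((∑ i, c i ^ 2) / 2) := by
  calc ∑ y : ι → Bool, Real.exp (∑ i, c i * bitSign (y i))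
      = ∏ i, ∑ b : Bool, Real.exp (c i * bitSign b) := by
        rw [Fintype.prod_sum]
        simp only [Real.exp_sum]
    _ ≤ ∏ i, (2 * Real.exp (c i ^ 2 / 2)) := by
        refine Finset.prod_le_prod (fun i _ => by positivity) fun i _ => ?_
        have h := Real.cosh_le_exp_half_sq (c i)
        rw [Real.cosh_eq] at h
        simp only [Fintype.sum_bool, bitSign, if_true, mul_one, mul_neg, Bool.false_eq_true,
          if_false]
        linarith
    _ = _ := by
        rw [Finset.prod_mul_distrib, ← Real.exp_sum, ← Finset.sum_div]
        simp

/-- The level-one inequality: the first-order bias of a subset `S` of the cube is controlled by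
the logarithm of its density. -/
theorem sum_sq_sum_bitSign_le {ι κ : Type*} [Fintype ι] [DecidableEq ι] [Fintype κ]
    (g : κ → ι) (hg : Function.Injective g) (S : Finset (ι → Bool)) (hS : S.Nonempty) :
    ∑ i, (∑ y ∈ S, bitSign (y (g i))) ^ 2 ≤
      2 * (S.card : ℝ) ^ 2 * Real.log (Fintype.card (ι → Bool) / S.card) := by
  classical
  have hs : (0 : ℝ) < S.card := by exact_mod_cast hS.card_pos
  set s : ℝ := (S.card : ℝ)
  set N : ℝ := (Fintype.card (ι → Bool) : ℝ) with hNdef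
  have hN : 0 < N := by
    rw [hNdef]
    exact_mod_cast Fintype.card_pos
  set a : κ → ℝ := fun i => ∑ y ∈ S, bitSign (y (g i)) with ha
  set W : ℝ := ∑ i, (a i / s) ^ 2 with hW
  -- The test direction is the mean bias vector of `S` itself: the linear form `c` then has mean `W`
  -- on `S`, and Jensen with the moment bound gives `exp W ≤ (N / s) exp (W / 2)`.
  set c : ι → ℝ := Function.extend g (fun i => a i / s) 0 with hc
  have hcg : ∀ i, c (g i) = a i / s := fun i => hg.extend_apply _ _ _
  have hc0 : ∀ i, i ∉ Set.range g → c i = 0 := fun i hi => by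
    simp only [hc, Function.extend_apply' _ _ _ hi, Pi.zero_apply]
  have hsum : ∀ F : ι → ℝ, (∀ i, i ∉ Set.range g → F i = 0) → ∑ i, F i = ∑ i, F (g i) :=
    fun F hF => (Fintype.sum_of_injective g hg _ _ hF fun _ => rfl).symm
  have hW2 : ∑ i, c i ^ 2 = W := by
    rw [hsum _ fun i hi => by simp [hc0 i hi]]
    simp only [hcg, hW]
  have hmean : ∑ y ∈ S, s⁻¹ * ∑ i, c i * bitSign (y i) = W := by
    have h1 : ∀ y : ι → Bool, ∑ i, c i * bitSign (y i) = ∑ i, a i / s * bitSign (y (g i)) := by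
      intro y
      rw [hsum _ fun i hi => by simp [hc0 i hi]]
      simp only [hcg]
    simp only [h1, Finset.mul_sum]
    rw [Finset.sum_comm]
    refine Finset.sum_congr rfl fun i _ => ?_
    simp only [← Finset.mul_sum]
    change s⁻¹ * (a i / s * a i) = _
    field_simp
  have hjensen : Real.exp W ≤ ∑ y ∈ S, s⁻¹ * Real.exp (∑ i, c i * bitSign (y i)) := by
    rw [← hmean]
    refine convexOn_exp.map_sum_le (fun _ _ => by positivity) ?_ (fun _ _ => Set.mem_univ _)
    rw [Finset.sum_const, nsmul_eq_mul]
    exact mul_inv_cancel₀ hs.ne'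
  have hexp : Real.exp W ≤ s⁻¹ * (N * Real.exp (W / 2)) := by
    refine hjensen.trans ?_
    rw [← Finset.mul_sum]
    refine mul_le_mul_of_nonneg_left ?_ (by positivity)
    refine (Finset.sum_le_univ_sum_of_nonneg fun y => (Real.exp_pos _).le).trans ?_
    rw [← hW2]
    exact sum_exp_linear_le c
  have hlog : W / 2 ≤ Real.log (N / s) := by
    rw [Real.le_log_iff_exp_le (by positivity)]
    have h2 : Real.exp W = Real.exp (W / 2) * Real.exp (W / 2) := by
      rw [← Real.exp_add]; ring_nf
    rw [h2] at hexp
    have h3 := Real.exp_pos (W / 2)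
    refine le_of_mul_le_mul_right (hexp.trans_eq ?_) h3
    field_simp
  have : ∑ i, a i ^ 2 = s ^ 2 * W := by
    rw [hW, Finset.mul_sum]
    refine Finset.sum_congr rfl fun i _ => ?_
    field_simp
  change ∑ i, a i ^ 2 ≤ _
  rw [this]
  nlinarith [mul_le_mul_of_nonneg_left hlog (sq_nonneg s)]

/-- The entropy of a partition is at most the logarithm of the number of its parts. -/
theorem sum_mul_log_div_le {L : Type*} [Fintype L] (s : L → ℝ) (hs : ∀ l, 0 ≤ s l) :
    ∑ l, s l * Real.log ((∑ m, s m) / s l) ≤ (∑ m, s m) * Real.log (Fintype.card L) := by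
  rcases isEmpty_or_nonempty L with hL | hL
  · simp
  have hc : (0 : ℝ) < Fintype.card L := by exact_mod_cast Fintype.card_pos
  set N := ∑ m, s m with hN
  -- From `log x ≤ x - 1`; the correction terms in parentheses sum to zero over `l`.
  have key : ∀ l, s l * Real.log (N / s l) ≤
      s l * Real.log (Fintype.card L) + (N / Fintype.card L - s l) := by
    intro l
    rcases (hs l).eq_or_lt with h | h
    · have : 0 ≤ N := Finset.sum_nonneg fun i _ => hs i
      rw [← h]
      simp only [zero_mul, sub_zero, zero_add]
      positivity
    · have hN0 : 0 < N := Finset.sum_pos' (fun i _ => hs i) ⟨l, Finset.mem_univ l, h⟩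
      have h1 := Real.log_le_sub_one_of_pos (x := N / s l / Fintype.card L) (by positivity)
      rw [Real.log_div (by positivity) hc.ne'] at h1
      have h2 := mul_le_mul_of_nonneg_left h1 h.le
      have h3 : s l * (N / s l / Fintype.card L - 1) = N / Fintype.card L - s l := by
        field_simp
      linarith
  refine (Finset.sum_le_sum fun l _ => key l).trans_eq ?_
  rw [Finset.sum_add_distrib, Finset.sum_sub_distrib, ← Finset.sum_mul, ← hN, Finset.sum_const,
    Finset.card_univ, nsmul_eq_mul]
  field_simp
  ring

/-! ### Merging parties pairwise in a Hilbert space. -/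

section Merging

variable {ι E : Type*} [DecidableEq ι] [NormedAddCommGroup E] [InnerProductSpace ℝ E]

/-- Among `m` vectors two can be found whose inner product is not very negative. -/
theorem exists_pair_neg_two_inner_le (s : Finset ι) (hs : 1 < s.card) (w : ι → E) :
    ∃ i ∈ s, ∃ j ∈ s, i ≠ j ∧
      -2 * inner ℝ (w i) (w j) ≤ 2 / (s.card * (s.card - 1)) * ∑ i ∈ s, ‖w i‖ ^ 2 := by
  have hm : (1 : ℝ) < s.card := by exact_mod_cast hs
  have hne : s.offDiag.Nonempty := by
    obtain ⟨i, hi, j, hj, hij⟩ := Finset.one_lt_card.mp hs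
    exact ⟨(i, j), Finset.mem_offDiag.mpr ⟨hi, hj, hij⟩⟩
  have hcard : (s.offDiag.card : ℝ) = s.card * (s.card - 1) := by
    rw [Finset.offDiag_card, Nat.cast_sub (Nat.le_mul_self _)]
    push_cast
    ring
  have hprod : ∑ p ∈ s.offDiag, inner ℝ (w p.1) (w p.2) + ∑ i ∈ s, ‖w i‖ ^ 2 =
      ‖∑ i ∈ s, w i‖ ^ 2 := by
    rw [← real_inner_self_eq_norm_sq, sum_inner]
    simp only [inner_sum]
    rw [← Finset.sum_product' s s (fun i j => inner ℝ (w i) (w j)), ← Finset.diag_union_offDiag,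
      Finset.sum_union (Finset.disjoint_diag_offDiag s), Finset.sum_diag, add_comm]
    simp
  -- Averaging over the ordered pairs: the off-diagonal inner products sum to at least `-∑ ‖w i‖²`.
  obtain ⟨⟨i, j⟩, hij, h⟩ := Finset.exists_le_of_sum_le (s := s.offDiag) hne
    (f := fun p => -2 * inner ℝ (w p.1) (w p.2))
    (g := fun _ => 2 / (s.card * (s.card - 1)) * ∑ i ∈ s, ‖w i‖ ^ 2) (by
      rw [Finset.sum_const, nsmul_eq_mul, hcard, ← Finset.mul_sum]
      have h0 : (0 : ℝ) < s.card * (s.card - 1) := by nlinarith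
      rw [← mul_assoc, mul_div_cancel₀ _ h0.ne']
      nlinarith [sq_nonneg ‖∑ i ∈ s, w i‖])
  obtain ⟨hi, hj, hne⟩ := Finset.mem_offDiag.mp hij
  exact ⟨i, hi, j, hj, hne, h⟩

/-- If the distance between `V A` and `V B` for disjoint `A` and `B` only depends on `A ∪ B`, then
the squared distances to `V ∅` are subadditive over disjoint unions, up to a constant factor. -/
theorem sq_norm_sub_biUnion_le (V : Finset ι → E)
    (hV : ∀ A B, Disjoint A B → ‖V A - V B‖ ^ 2 = ‖V (A ∪ B) - V ∅‖ ^ 2) (m : ℕ) :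
    ∀ (s : Finset ι) (A : ι → Finset ι), s.card = m + 1 →
      (s : Set ι).PairwiseDisjoint A →
      ‖V (s.biUnion A) - V ∅‖ ^ 2 ≤
        Real.exp (2 * (1 - 1 / (m + 1))) * ∑ i ∈ s, ‖V (A i) - V ∅‖ ^ 2 := by
  induction m with
  | zero =>
    intro s A hs _
    obtain ⟨i, rfl⟩ := Finset.card_eq_one.mp hs
    simp
  | succ m ih =>
    intro s A hs hA
    obtain ⟨i, hi, j, hj, hij, h⟩ :=
      exists_pair_neg_two_inner_le s (by omega) fun i => V (A i) - V ∅
    set Q := ∑ i ∈ s, ‖V (A i) - V ∅‖ ^ 2 with hQ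
    have hQ0 : 0 ≤ Q := Finset.sum_nonneg fun _ _ => sq_nonneg _
    set A' := Function.update A i (A i ∪ A j) with hA'
    have hi' : i ∈ s.erase j := Finset.mem_erase.mpr ⟨hij, hi⟩
    have hoff : ∀ l ∈ (s.erase j).erase i, A' l = A l := fun l hl =>
      Function.update_of_ne (Finset.ne_of_mem_erase hl) _ _
    have hAi : A' i = A i ∪ A j := Function.update_self _ _ _
    have hunion : (s.erase j).biUnion A' = s.biUnion A := by
      conv_lhs => rw [← Finset.insert_erase hi', Finset.biUnion_insert, hAi,
        Finset.biUnion_congr rfl hoff]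
      conv_rhs => rw [← Finset.insert_erase hj, Finset.biUnion_insert, ← Finset.insert_erase hi',
        Finset.biUnion_insert]
      ac_rfl
    have hdisj : ((s.erase j : Finset ι) : Set ι).PairwiseDisjoint A' := by
      have hmem : ∀ l ∈ (s.erase j : Finset ι), l ≠ i → Disjoint (A' i) (A' l) := by
        intro l hl hli
        have hls := Finset.mem_of_mem_erase hl
        have hlj := Finset.ne_of_mem_erase hl
        rw [hAi, hoff l (Finset.mem_erase.mpr ⟨hli, hl⟩), Finset.disjoint_union_left]
        exact ⟨hA hi hls hli.symm, hA hj hls hlj.symm⟩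
      intro a ha b hb hab
      by_cases hai : a = i
      · subst hai
        exact hmem b hb hab.symm
      by_cases hbi : b = i
      · subst hbi
        exact (hmem a ha hab).symm
      · have h1 := hoff a (Finset.mem_erase.mpr ⟨hai, ha⟩)
        have h2 := hoff b (Finset.mem_erase.mpr ⟨hbi, hb⟩)
        change Disjoint (A' a) (A' b)
        rw [h1, h2]
        exact hA (Finset.mem_of_mem_erase ha) (Finset.mem_of_mem_erase hb) hab
    have hstep := ih (s.erase j) A' (by rw [Finset.card_erase_of_mem hj]; omega) hdisj
    rw [hunion] at hstep
    -- The hypothesis `hV` trades the distance from the union to `∅` for the distance between the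
    -- two parts, where the law of cosines applies.
    have hmerge : ‖V (A i ∪ A j) - V ∅‖ ^ 2 = ‖V (A i) - V ∅‖ ^ 2 + ‖V (A j) - V ∅‖ ^ 2 +
        -2 * inner ℝ (V (A i) - V ∅) (V (A j) - V ∅) := by
      rw [← hV _ _ (hA hi hj hij), ← sub_sub_sub_cancel_right (V (A i)) (V (A j)) (V ∅),
        norm_sub_sq_real]
      ring
    have hsum : ∑ l ∈ s.erase j, ‖V (A' l) - V ∅‖ ^ 2 =
        Q + -2 * inner ℝ (V (A i) - V ∅) (V (A j) - V ∅) := by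
      rw [← Finset.add_sum_erase _ _ hi', hAi, hmerge,
        Finset.sum_congr rfl fun l hl => by rw [hoff l hl], hQ, ← Finset.add_sum_erase _ _ hj,
        ← Finset.add_sum_erase _ _ hi']
      ring
    rw [hsum] at hstep
    have hm : (s.card : ℝ) = m + 2 := by rw [hs]; push_cast; ring
    rw [hm] at h
    refine hstep.trans ?_
    -- Going from `m + 2` sets to `m + 1` costs a factor `1 + 2 / ((m + 2) (m + 1))`, at most the
    -- exponential of a term that telescopes.
    have hexp : Real.exp (2 * (1 - 1 / ((m + 1 : ℕ) + 1 : ℝ))) =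
        Real.exp (2 * (1 - 1 / (m + 1))) * Real.exp (2 / ((m + 2) * (m + 2 - 1))) := by
      rw [← Real.exp_add]
      congr 1
      push_cast
      have h1 : (m + 1 : ℝ) ≠ 0 := by positivity
      have h2 : (m + 2 : ℝ) ≠ 0 := by positivity
      have h3 : (m + 2 - 1 : ℝ) = m + 1 := by ring
      have h4 : (m + 1 + 1 : ℝ) = m + 2 := by ring
      rw [h3, h4]
      field_simp
      ring
    rw [hexp, mul_assoc]
    refine mul_le_mul_of_nonneg_left ?_ (Real.exp_pos _).le
    nlinarith [mul_le_mul_of_nonneg_right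
      (Real.add_one_le_exp (2 / ((m + 2) * (m + 2 - 1) : ℝ))) hQ0]

theorem sq_norm_sub_univ_le [Fintype ι] (V : Finset ι → E)
    (hV : ∀ A B, Disjoint A B → ‖V A - V B‖ ^ 2 = ‖V (A ∪ B) - V ∅‖ ^ 2) :
    ‖V Finset.univ - V ∅‖ ^ 2 ≤ Real.exp 2 * ∑ i, ‖V {i} - V ∅‖ ^ 2 := by
  rcases isEmpty_or_nonempty ι with h | h
  · simp [Finset.univ_eq_empty]
  obtain ⟨m, hm⟩ := Nat.exists_eq_succ_of_ne_zero (Fintype.card_ne_zero (α := ι))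
  have h1 := sq_norm_sub_biUnion_le V hV m Finset.univ (fun i => {i}) hm
    (fun a _ b _ hab => by simpa [Function.onFun] using hab)
  have h2 : (Finset.univ : Finset ι).biUnion (fun i => ({i} : Finset ι)) = Finset.univ := by
    ext; simp
  rw [h2] at h1
  refine h1.trans (mul_le_mul_of_nonneg_right (Real.exp_le_exp.mpr ?_)
    (Finset.sum_nonneg fun _ _ => sq_nonneg _))
  have : (0 : ℝ) ≤ 1 / (m + 1) := by positivity
  linarith

end Merging

/-! ### The hard inputs. -/

section HardInputs

variable {k n : ℕ}

/-- The input in which only party `d i` may hold the element `i`, and does so if its coin for `i`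
says so. -/
def baseInput (d : Fin n → Fin k) (y : Fin k × Fin n → Bool) : Fin k → Fin n → Bool :=
  fun j i => decide (d i = j) && y (j, i)

/-- The modification of `baseInput` in which precisely the parties in `A` hold the element `i`. -/
def plantedInput (d : Fin n → Fin k) (i : Fin n) (A : Finset (Fin k)) (y : Fin k × Fin n → Bool) :
    Fin k → Fin n → Bool :=
  fun j => Function.update (baseInput d y j) i (decide (j ∈ A))

theorem sum_toNat_baseInput_le (d : Fin n → Fin k) (y : Fin k × Fin n → Bool) (i : Fin n) :
    ∑ j, (baseInput d y j i).toNat ≤ 1 := by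
  rw [Finset.sum_eq_single_of_mem (d i) (Finset.mem_univ _)]
  · exact Bool.toNat_le _
  · intro j _ hj
    simp [baseInput, hj.symm]

theorem plantedInput_empty_mem (d : Fin n → Fin k) (i : Fin n) (y : Fin k × Fin n → Bool) :
    plantedInput d i ∅ y ∈ udisjNo k n := by
  intro i'
  rcases eq_or_ne i' i with rfl | h
  · simp [plantedInput]
  · simpa [plantedInput, h] using sum_toNat_baseInput_le d y i'

theorem plantedInput_univ_mem (d : Fin n → Fin k) (i : Fin n) (y : Fin k × Fin n → Bool) :
    plantedInput d i Finset.univ y ∈ udisjYes k n := by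
  refine ⟨i, fun j => by simp [plantedInput], fun i' h => ?_⟩
  simpa [plantedInput, h] using sum_toNat_baseInput_le d y i'

theorem plantedInput_update_left (d : Fin n → Fin k) (i : Fin n) (j : Fin k)
    (A : Finset (Fin k)) (y : Fin k × Fin n → Bool) :
    plantedInput (Function.update d i j) i A y = plantedInput d i A y := by
  funext j' i'
  rcases eq_or_ne i' i with rfl | h
  · simp [plantedInput]
  · simp [plantedInput, baseInput, h]

theorem plantedInput_update_right (d : Fin n → Fin k) (i : Fin n) (j : Fin k) (b : Bool)
    (A : Finset (Fin k)) (y : Fin k × Fin n → Bool) :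
    plantedInput d i A (Function.update y (j, i) b) = plantedInput d i A y := by
  funext j' i'
  rcases eq_or_ne i' i with rfl | h
  · simp [plantedInput]
  · simp [plantedInput, baseInput, h]

/-- Fixing the owner's coin makes the base input a planted one; this ties the bias of that coin on a
leaf to the planted counts for `{d i}` and `∅`. -/
theorem plantedInput_self (d : Fin n → Fin k) (i : Fin n) (y : Fin k × Fin n → Bool) :
    plantedInput d i (if y (d i, i) then {d i} else ∅) y = baseInput d y := by
  funext j i'
  rcases eq_or_ne i' i with rfl | h
  · rcases eq_or_ne j (d i') with rfl | hj
    · cases hb : y (d i', i') <;> simp [plantedInput, baseInput, hb]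
    · cases hb : y (d i', i') <;> simp [plantedInput, baseInput, hj, hj.symm]
  · simp [plantedInput, h]

/-- Half of the points with a property that does not depend on the coordinate `p` have a given
value there. -/
theorem two_mul_card_filter_coord {ι : Type*} [Fintype ι] [DecidableEq ι] (p : ι)
    (Q : (ι → Bool) → Prop) [DecidablePred Q] (hQ : ∀ y b, Q (Function.update y p b) ↔ Q y)
    (b : Bool) :
    2 * (Finset.univ.filter fun y : ι → Bool => y p = b ∧ Q y).card =
      (Finset.univ.filter Q).card := by
  have hflip : (Finset.univ.filter fun y : ι → Bool => y p = b ∧ Q y).card =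
      (Finset.univ.filter fun y : ι → Bool => ¬ y p = b ∧ Q y).card := by
    refine Finset.card_nbij' (fun y => Function.update y p (!y p))
      (fun y => Function.update y p (!y p)) ?_ ?_ ?_ ?_
    · intro y hy
      simpa [hQ] using hy
    · intro y hy
      simp only [Finset.coe_filter, Finset.mem_univ, true_and, Set.mem_ofPred_eq] at hy ⊢
      refine ⟨?_, (hQ _ _).mpr hy.2⟩
      have := hy.1
      simp only [Function.update_self]
      cases h : y p <;> cases b <;> simp_all
    · intro y _
      simp
    · intro y _
      simp
  have := Finset.card_filter_add_card_filter_not (s := Finset.univ.filter Q) (fun y => y p = b)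
  rw [Finset.filter_filter, Finset.filter_filter] at this
  simp only [and_comm (a := Q _)] at this
  omega

/-! ### Planted counts and cut-and-paste. -/

variable {L : Type} [DecidableEq L] (f : (Fin k → Fin n → Bool) → L)

/-- The number of coin tosses for which the planted input is mapped to `l`. -/
def plantedCount (d : Fin n → Fin k) (i : Fin n) (A : Finset (Fin k)) (l : L) : ℕ :=
  (Finset.univ.filter fun y => f (plantedInput d i A y) = l).card

theorem sum_plantedCount [Fintype L] (d : Fin n → Fin k) (i : Fin n) (A : Finset (Fin k)) :
    ∑ l, plantedCount f d i A l = Fintype.card (Fin k × Fin n → Bool) :=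
  (Finset.card_eq_sum_card_fiberwise (fun _ _ => Finset.mem_univ _)).symm

theorem sum_plantedCount_cast [Fintype L] (d : Fin n → Fin k) (i : Fin n) (A : Finset (Fin k)) :
    ∑ l, (plantedCount f d i A l : ℝ) = (Fintype.card (Fin k × Fin n → Bool) : ℝ) := by
  rw [← sum_plantedCount f d i A, Nat.cast_sum]

theorem plantedCount_update (d : Fin n → Fin k) (i : Fin n) (j : Fin k) (A : Finset (Fin k))
    (l : L) : plantedCount f (Function.update d i j) i A l = plantedCount f d i A l := by
  simp only [plantedCount, plantedInput_update_left]

/-- Given `d`, party `j`'s input uses only the coins `y (j, ·)`, so counting points of a rectangle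
factors over the parties. -/
theorem plantedCount_eq_prod {R : L → Fin k → Set (Fin n → Bool)}
    (hR : ∀ x l, f x = l ↔ ∀ j, x j ∈ R l j) (d : Fin n → Fin k) (i : Fin n)
    (l : L) : ∃ c : Fin k → Bool → ℕ, ∀ A : Finset (Fin k),
      plantedCount f d i A l = ∏ j, c j (decide (j ∈ A)) := by
  classical
  let row : Fin k → Bool → (Fin n → Bool) → Fin n → Bool :=
    fun j b z => Function.update (fun i => decide (d i = j) && z i) i b
  refine ⟨fun j b => (Finset.univ.filter fun z => row j b z ∈ R l j).card, fun A => ?_⟩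
  rw [← Fintype.card_piFinset, plantedCount]
  refine Finset.card_equiv (Equiv.curry _ _ _) fun y => ?_
  simp only [Finset.mem_filter, Finset.mem_univ, true_and, hR, Fintype.mem_piFinset]
  rfl

/-- The cut-and-paste property. -/
theorem plantedCount_mul {R : L → Fin k → Set (Fin n → Bool)}
    (hR : ∀ x l, f x = l ↔ ∀ j, x j ∈ R l j) (d : Fin n → Fin k) (i : Fin n)
    (l : L) {A B : Finset (Fin k)} (h : Disjoint A B) :
    plantedCount f d i A l * plantedCount f d i B l =
      plantedCount f d i (A ∪ B) l * plantedCount f d i ∅ l := by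
  obtain ⟨c, hc⟩ := plantedCount_eq_prod f hR d i l
  simp only [hc, ← Finset.prod_mul_distrib]
  refine Finset.prod_congr rfl fun j _ => ?_
  by_cases hA : j ∈ A
  · simp [hA, Finset.disjoint_left.mp h hA]
  · by_cases hB : j ∈ B <;> simp [hA, hB, mul_comm]

theorem two_mul_card_baseInput_coord (d : Fin n → Fin k) (i : Fin n) (l : L) (b : Bool) :
    2 * ((Finset.univ.filter fun y => f (baseInput d y) = l).filter
      fun y => y (d i, i) = b).card = plantedCount f d i (if b then {d i} else ∅) l := by
  rw [plantedCount, ← two_mul_card_filter_coord (d i, i) _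
    (fun y b' => by rw [plantedInput_update_right]) b, Finset.filter_filter]
  congr 2
  ext y
  simp only [Finset.mem_filter, Finset.mem_univ, true_and]
  rw [and_comm]
  refine and_congr_right fun h => ?_
  rw [← plantedInput_self d i y, h]

theorem card_baseInput (d : Fin n → Fin k) (i : Fin n) (l : L) :
    ((Finset.univ.filter fun y => f (baseInput d y) = l).card : ℝ) =
      (plantedCount f d i {d i} l + plantedCount f d i ∅ l) / 2 := by
  have h1 := two_mul_card_baseInput_coord f d i l true
  have h2 := two_mul_card_baseInput_coord f d i l false
  simp only [if_true, Bool.false_eq_true, if_false] at h1 h2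
  have h3 := Finset.card_filter_add_card_filter_not
    (s := Finset.univ.filter fun y => f (baseInput d y) = l) (fun y => y (d i, i) = true)
  simp only [Bool.not_eq_true] at h3
  rw [← h1, ← h2, ← h3]
  push_cast
  ring

theorem sum_bitSign_baseInput (d : Fin n → Fin k) (i : Fin n) (l : L) :
    ∑ y ∈ Finset.univ.filter (fun y => f (baseInput d y) = l), bitSign (y (d i, i)) =
      ((plantedCount f d i {d i} l : ℝ) - plantedCount f d i ∅ l) / 2 := by
  have h1 := two_mul_card_baseInput_coord f d i l true
  have h2 := two_mul_card_baseInput_coord f d i l false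
  simp only [if_true, Bool.false_eq_true, if_false] at h1 h2
  simp only [bitSign]
  rw [Finset.sum_ite, Finset.sum_const, Finset.sum_const]
  simp only [Bool.not_eq_true, nsmul_eq_mul]
  rw [← h1, ← h2]
  push_cast
  ring

/-! ### Hellinger distances between planted inputs. -/

/-- The (unnormalized) squared Hellinger distance between the values of `f` with the parties in `A`
planted, and with no party planted. -/
noncomputable def plantedHellinger [Fintype L] (d : Fin n → Fin k) (i : Fin n)
    (A : Finset (Fin k)) : ℝ :=
  ∑ l, (√(plantedCount f d i A l) - √(plantedCount f d i ∅ l)) ^ 2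

theorem sq_sqrt_sub_sqrt_le {p q : ℝ} (hp : 0 ≤ p) (hq : 0 ≤ q) (hpq : 0 < p + q) :
    (√p - √q) ^ 2 ≤ (p - q) ^ 2 / (p + q) := by
  rw [le_div_iff₀ hpq]
  have h1 := Real.sq_sqrt hp
  have h2 := Real.sq_sqrt hq
  have h3 := mul_nonneg (Real.sqrt_nonneg p) (Real.sqrt_nonneg q)
  have h4 : (p - q) ^ 2 = (√p - √q) ^ 2 * (p + q + 2 * (√p * √q)) := by
    calc (p - q) ^ 2 = (√p ^ 2 - √q ^ 2) ^ 2 := by rw [h1, h2]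
      _ = (√p - √q) ^ 2 * (√p ^ 2 + √q ^ 2 + 2 * (√p * √q)) := by ring
      _ = _ := by rw [h1, h2]
  rw [h4]
  exact mul_le_mul_of_nonneg_left (by linarith) (sq_nonneg _)

/-- On a leaf of size `s l`, the term for `i` is at most `2 / s l` times the squared bias of the
owner's coin. The level-one inequality turns the sum over `i` into `4 s l log (N / s l)`, with `N`
the number of coin tosses, and the entropy bound sums this over leaves. -/
theorem sum_plantedHellinger_le [Fintype L] (d : Fin n → Fin k) :
    ∑ i, plantedHellinger f d i {d i} ≤
      4 * (Fintype.card (Fin k × Fin n → Bool) * Real.log (Fintype.card L)) := by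
  classical
  set s : L → ℝ := fun l => ((Finset.univ.filter fun y => f (baseInput d y) = l).card : ℝ) with hs
  have hsum : ∑ l, s l = Fintype.card (Fin k × Fin n → Bool) := by
    simp only [hs]
    exact_mod_cast
      (Finset.card_eq_sum_card_fiberwise (fun _ _ => Finset.mem_univ _)).symm
  have hent := sum_mul_log_div_le s fun l => Nat.cast_nonneg _
  rw [hsum] at hent
  refine le_trans ?_ (mul_le_mul_of_nonneg_left hent (by norm_num))
  simp only [plantedHellinger]
  rw [Finset.sum_comm, Finset.mul_sum]
  refine Finset.sum_le_sum fun l _ => ?_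
  have hcard := fun i => card_baseInput f d i l
  rcases (Finset.univ.filter fun y => f (baseInput d y) = l).eq_empty_or_nonempty with h0 | hne
  · have : s l = 0 := by simp [hs, h0]
    rw [this, zero_mul, mul_zero]
    refine (Finset.sum_eq_zero fun i _ => ?_).le
    have h := hcard i
    rw [h0, Finset.card_empty, Nat.cast_zero] at h
    have h1 : (0 : ℝ) ≤ plantedCount f d i {d i} l := Nat.cast_nonneg _
    have h2 : (0 : ℝ) ≤ plantedCount f d i ∅ l := Nat.cast_nonneg _
    have h3 : (plantedCount f d i {d i} l : ℝ) = 0 := by linarith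
    have h4 : (plantedCount f d i ∅ l : ℝ) = 0 := by linarith
    rw [h3, h4]
    simp
  · have hpos : 0 < s l := by
      simp only [hs]
      exact_mod_cast hne.card_pos
    have hlev := sum_sq_sum_bitSign_le (fun i => (d i, i))
      (fun a b h => (Prod.mk.inj h).2) _ hne
    have hi : ∀ i, (√(plantedCount f d i {d i} l) - √(plantedCount f d i ∅ l)) ^ 2 ≤
        2 / s l * (∑ y ∈ Finset.univ.filter (fun y => f (baseInput d y) = l),
          bitSign (y (d i, i))) ^ 2 := by
      intro i
      have hsl : s l = _ := hcard i
      refine (sq_sqrt_sub_sqrt_le (Nat.cast_nonneg _) (Nat.cast_nonneg _)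
        (by linarith)).trans_eq ?_
      rw [sum_bitSign_baseInput]
      have h5 : (plantedCount f d i {d i} l : ℝ) + plantedCount f d i ∅ l = 2 * s l := by
        linarith
      rw [h5]
      field_simp
    refine (Finset.sum_le_sum fun i _ => hi i).trans ?_
    rw [← Finset.mul_sum]
    refine (mul_le_mul_of_nonneg_left hlev (by positivity)).trans_eq ?_
    change 2 / s l * (2 * s l ^ 2 * Real.log (_ / s l)) = _
    field_simp
    ring

theorem plantedHellinger_univ_le [Fintype L] {R : L → Fin k → Set (Fin n → Bool)}
    (hR : ∀ x l, f x = l ↔ ∀ j, x j ∈ R l j) (d : Fin n → Fin k) (i : Fin n) :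
    plantedHellinger f d i Finset.univ ≤ Real.exp 2 * ∑ j, plantedHellinger f d i {j} := by
  let V : Finset (Fin k) → EuclideanSpace ℝ L :=
    fun A => WithLp.toLp 2 fun l => √(plantedCount f d i A l)
  have hsub : ∀ A B, ‖V A - V B‖ ^ 2 =
      ∑ l, (√(plantedCount f d i A l) - √(plantedCount f d i B l)) ^ 2 := by
    intro A B
    simp [EuclideanSpace.norm_sq_eq, V]
  -- Every `V A` has squared norm equal to the number of coin tosses, so distances depend only on
  -- products of counts, which cut-and-paste rewrites.
  have hexpand : ∀ A B, ∑ l, (√(plantedCount f d i A l) - √(plantedCount f d i B l)) ^ 2 =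
      2 * (Fintype.card (Fin k × Fin n → Bool) : ℝ) -
        2 * ∑ l, √((plantedCount f d i A l * plantedCount f d i B l : ℕ) : ℝ) := by
    intro A B
    have hA := sum_plantedCount_cast f d i A
    have hB := sum_plantedCount_cast f d i B
    rw [two_mul (Fintype.card _ : ℝ)]
    nth_rw 1 [← hA]
    rw [← hB, Finset.mul_sum, ← Finset.sum_add_distrib, ← Finset.sum_sub_distrib]
    refine Finset.sum_congr rfl fun l _ => ?_
    rw [Nat.cast_mul, Real.sqrt_mul (Nat.cast_nonneg _), sub_sq,
      Real.sq_sqrt (Nat.cast_nonneg _), Real.sq_sqrt (Nat.cast_nonneg _)]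
    ring
  have h := sq_norm_sub_univ_le V fun A B hAB => by
    simp only [hsub, hexpand, plantedCount_mul f hR d i _ hAB]
  simpa only [hsub, plantedHellinger] using h

/-- Resampling one coordinate of a uniformly random function does not change its law. -/
theorem card_mul_sum_coord {ι κ : Type*} [Fintype ι] [DecidableEq ι] [Fintype κ]
    (i : ι) (F : (ι → κ) → κ → ℝ) (hF : ∀ d j j', F (Function.update d i j) j' = F d j') :
    (Fintype.card κ : ℝ) * ∑ d, F d (d i) = ∑ d, ∑ j, F d j := by
  let e : (ι → κ) × κ ≃ (ι → κ) × κ :=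
    Function.Involutive.toPerm (fun p => (Function.update p.1 i p.2, p.1 i)) fun p => by simp
  have h := Equiv.sum_comp e fun p => F p.1 (p.1 i)
  have he : ∀ p, F (e p).1 ((e p).1 i) = F p.1 p.2 := fun p => by
    change F (Function.update p.1 i p.2) (Function.update p.1 i p.2 i) = _
    rw [Function.update_self, hF]
  simp only [he] at h
  rw [Fintype.sum_prod_type, Fintype.sum_prod_type] at h
  rw [h]
  simp [Finset.mul_sum]

theorem sum_plantedHellinger_univ_le [Fintype L] {R : L → Fin k → Set (Fin n → Bool)}
    (hR : ∀ x l, f x = l ↔ ∀ j, x j ∈ R l j) :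
    ∑ d, ∑ i, plantedHellinger f d i Finset.univ ≤
      Real.exp 2 * (k * (Fintype.card (Fin n → Fin k) *
        (4 * (Fintype.card (Fin k × Fin n → Bool) * Real.log (Fintype.card L))))) := by
  calc ∑ d, ∑ i, plantedHellinger f d i Finset.univ
      ≤ ∑ d, ∑ i, Real.exp 2 * ∑ j, plantedHellinger f d i {j} :=
        Finset.sum_le_sum fun d _ => Finset.sum_le_sum fun i _ =>
          plantedHellinger_univ_le f hR d i
    _ = Real.exp 2 * ∑ i, ∑ d, ∑ j, plantedHellinger f d i {j} := by
        rw [Finset.sum_comm]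
        simp only [Finset.mul_sum]
    _ = Real.exp 2 * (k * ∑ d, ∑ i, plantedHellinger f d i {d i}) := by
        rw [Finset.sum_comm (s := Finset.univ (α := Fin n → Fin k)), Finset.mul_sum (a := (k : ℝ))]
        congr 1
        refine Finset.sum_congr rfl fun i _ => ?_
        -- The count at `i` does not see `d i`, so a sum over all parties equals `k` times the value
        -- at the owner.
        have := card_mul_sum_coord i (fun d j => plantedHellinger f d i {j}) fun d j j' => by
          simp only [plantedHellinger, plantedCount_update]
        rw [Fintype.card_fin] at this
        exact this.symm
    _ ≤ _ := by
        refine mul_le_mul_of_nonneg_left (mul_le_mul_of_nonneg_left ?_ (Nat.cast_nonneg _))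
          (Real.exp_pos _).le
        refine (Finset.sum_le_sum fun d _ => sum_plantedHellinger_le f d).trans_eq ?_
        rw [Finset.sum_const, Finset.card_univ, nsmul_eq_mul]

/-- The Hellinger distance is bounded below by the statistical distance of any two-valued
statistic. -/
theorem sq_sum_sub_le_plantedHellinger [Fintype L] (out : L → Bool) (d : Fin n → Fin k)
    (i : Fin n) :
    (∑ y, ((if out (f (plantedInput d i Finset.univ y)) then (1 : ℝ) else 0) -
        if out (f (plantedInput d i ∅ y)) then (1 : ℝ) else 0)) ^ 2 ≤
      4 * Fintype.card (Fin k × Fin n → Bool) * plantedHellinger f d i Finset.univ := by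
  have hfib : ∀ A, ∑ y, (if out (f (plantedInput d i A y)) then (1 : ℝ) else 0) =
      ∑ l, (if out l then (1 : ℝ) else 0) * plantedCount f d i A l := by
    intro A
    rw [← Finset.sum_fiberwise' Finset.univ (fun y => f (plantedInput d i A y))
      (fun l => if out l then (1 : ℝ) else 0)]
    refine Finset.sum_congr rfl fun l _ => ?_
    rw [Finset.sum_const, nsmul_eq_mul, mul_comm]
    rfl
  rw [Finset.sum_sub_distrib, hfib, hfib, ← Finset.sum_sub_distrib]
  -- The factorization `p - q = (√p - √q)(√p + √q)` prepares Cauchy–Schwarz.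
  have hterm : ∀ l, (if out l then (1 : ℝ) else 0) * plantedCount f d i Finset.univ l -
      (if out l then (1 : ℝ) else 0) * plantedCount f d i ∅ l =
      (√(plantedCount f d i Finset.univ l) - √(plantedCount f d i ∅ l)) *
      ((if out l then (1 : ℝ) else 0) *
        (√(plantedCount f d i Finset.univ l) + √(plantedCount f d i ∅ l))) := by
    intro l
    have h1 := Real.sq_sqrt (Nat.cast_nonneg (α := ℝ) (plantedCount f d i Finset.univ l))
    have h2 := Real.sq_sqrt (Nat.cast_nonneg (α := ℝ) (plantedCount f d i ∅ l))
    linear_combination (if out l then (1 : ℝ) else 0) * h2 - (if out l then (1 : ℝ) else 0) * h1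
  simp only [hterm]
  refine (Finset.sum_mul_sq_le_sq_mul_sq _ _ _).trans ?_
  rw [mul_comm]
  refine mul_le_mul_of_nonneg_right ?_ (Finset.sum_nonneg fun _ _ => sq_nonneg _)
  calc _ ≤ ∑ l, (2 * (plantedCount f d i Finset.univ l : ℝ) + 2 * plantedCount f d i ∅ l) := by
        refine Finset.sum_le_sum fun l _ => ?_
        have h1 := Real.sq_sqrt (Nat.cast_nonneg (α := ℝ) (plantedCount f d i Finset.univ l))
        have h2 := Real.sq_sqrt (Nat.cast_nonneg (α := ℝ) (plantedCount f d i ∅ l))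
        split_ifs
        · nlinarith [sq_nonneg (√(plantedCount f d i Finset.univ l) -
            √(plantedCount f d i ∅ l) : ℝ)]
        · simp only [zero_mul, ne_eq, OfNat.ofNat_ne_zero, not_false_eq_true, zero_pow]
          positivity
    _ = _ := by
        rw [Finset.sum_add_distrib, ← Finset.mul_sum, ← Finset.mul_sum, sum_plantedCount_cast,
          sum_plantedCount_cast]
        ring

end HardInputs

/-! ### From acceptance gaps to the cost bound. -/

section LowerBound

variable {k n : ℕ}

/-- The difference between the numbers of coin tosses for which `g` accepts the planted yes instance
and the planted no instance. -/
def acceptanceGap (g : (Fin k → Fin n → Bool) → Bool) (d : Fin n → Fin k) (i : Fin n) : ℝ :=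
  ∑ y, ((if g (plantedInput d i Finset.univ y) then (1 : ℝ) else 0) -
    if g (plantedInput d i ∅ y) then (1 : ℝ) else 0)

theorem sum_sq_acceptanceGap_le (π : Protocol k (Fin n → Bool)) {C : ℕ} (hC : π.cost ≤ C) :
    ∑ d, ∑ i, acceptanceGap π.run d i ^ 2 ≤
      16 * Real.exp 2 * Real.log 2 * (k * C) * (Fintype.card (Fin n → Fin k) *
        (Fintype.card (Fin k × Fin n → Bool) : ℝ) ^ 2) := by
  classical
  obtain ⟨L, _, R, f, out, hcard, hR, hrun⟩ := π.exists_rectangles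
  have : Nonempty L := ⟨f fun _ _ => true⟩
  have hlog : Real.log (Fintype.card L) ≤ C * Real.log 2 := by
    rw [← Real.log_pow]
    refine Real.log_le_log (by exact_mod_cast Fintype.card_pos) ?_
    exact_mod_cast hcard.trans (Nat.pow_le_pow_right (by norm_num) hC)
  set N : ℝ := (Fintype.card (Fin k × Fin n → Bool) : ℝ)
  have hN : 0 ≤ N := Nat.cast_nonneg _
  calc ∑ d, ∑ i, acceptanceGap π.run d i ^ 2
      ≤ ∑ d, ∑ i, 4 * N * plantedHellinger f d i Finset.univ := by
        refine Finset.sum_le_sum fun d _ => Finset.sum_le_sum fun i _ => ?_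
        simp only [acceptanceGap, hrun]
        exact sq_sum_sub_le_plantedHellinger f out d i
    _ = 4 * N * ∑ d, ∑ i, plantedHellinger f d i Finset.univ := by
        simp only [Finset.mul_sum]
    _ ≤ 4 * N * (Real.exp 2 * (k * (Fintype.card (Fin n → Fin k) *
          (4 * (N * (C * Real.log 2)))))) := by
        refine mul_le_mul_of_nonneg_left ((sum_plantedHellinger_univ_le f hR).trans ?_)
          (by positivity)
        gcongr
    _ = _ := by ring

theorem PMF.toReal_map_apply_eq_sum {α β : Type*} [Fintype α] [DecidableEq β] (ν : PMF α)
    (h : α → β) (b : β) :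
    ((ν.map h) b).toReal = ∑ a, (ν a).toReal * if h a = b then 1 else 0 := by
  classical
  rw [PMF.map_apply, tsum_fintype, ENNReal.toReal_sum fun a _ => by
    split_ifs
    · exact ν.apply_ne_top a
    · exact ENNReal.zero_ne_top]
  refine Finset.sum_congr rfl fun a _ => ?_
  by_cases hb : h a = b
  · simp [hb]
  · simp [hb, Ne.symm hb]

/-- A randomized protocol with error at most `ε` costs at least a constant times `n / k`. -/
theorem ComputesWithError.le_cost {ε : ℝ} (hk : 0 < k) (hε : ε < 1 / 2)
    {μ : PMF (Protocol k (Fin n → Bool))}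
    (hμ : ComputesWithError μ (udisjNo k n) (udisjYes k n) ε) {C : ℕ}
    (hC : ∀ π ∈ μ.support, π.cost ≤ C) :
    (1 - 2 * ε) ^ 2 * n ≤ 16 * Real.exp 2 * Real.log 2 * (k * C) := by
  classical
  have : Nonempty (Fin k) := ⟨⟨0, hk⟩⟩
  -- Protocols form an infinite type, but the functions they compute form a finite one, so
  -- expectations become finite sums.
  set ν : PMF ((Fin k → Fin n → Bool) → Bool) := μ.map Protocol.run with hν
  set w : ((Fin k → Fin n → Bool) → Bool) → ℝ := fun g => (ν g).toReal with hw
  have hw0 : ∀ g, 0 ≤ w g := fun g => ENNReal.toReal_nonneg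
  have hw1 : ∑ g, w g = 1 := by
    have h := ν.tsum_coe
    rw [tsum_fintype] at h
    simp only [hw]
    rw [← ENNReal.toReal_sum fun g _ => ν.apply_ne_top g, h, ENNReal.toReal_one]
  have hout : ∀ x b, ((μ.map fun π => π.run x) b).toReal =
      ∑ g, w g * if g x = b then 1 else 0 := by
    intro x b
    rw [← PMF.toReal_map_apply_eq_sum ν (fun g => g x) b, hν, PMF.map_comp]
    rfl
  set t := 1 - 2 * ε with ht
  have ht0 : 0 < t := by linarith
  have hgap : ∀ x ∈ udisjYes k n, ∀ x' ∈ udisjNo k n,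
      t ≤ ∑ g, w g * ((if g x then (1 : ℝ) else 0) - if g x' then (1 : ℝ) else 0) := by
    intro x hx x' hx'
    have h1 := hμ.2 x hx
    have h2 := hμ.1 x' hx'
    rw [hout] at h1 h2
    have h3 : ∑ g, w g * ((if g x then (1 : ℝ) else 0) - if g x' then (1 : ℝ) else 0) =
        ∑ g, w g - ∑ g, w g * (if g x = false then 1 else 0) -
          ∑ g, w g * (if g x' = true then 1 else 0) := by
      rw [← Finset.sum_sub_distrib, ← Finset.sum_sub_distrib]
      refine Finset.sum_congr rfl fun g _ => ?_
      cases g x <;> cases g x' <;> simp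
    rw [h3, hw1]
    linarith
  set N : ℝ := (Fintype.card (Fin k × Fin n → Bool) : ℝ) with hNdef
  have hN : 0 < N := by
    rw [hNdef]
    exact_mod_cast Fintype.card_pos
  set M : ℝ := (Fintype.card (Fin n → Fin k) : ℝ) with hMdef
  have hM : 0 < M := by
    rw [hMdef]
    exact_mod_cast Fintype.card_pos
  have hmean : ∀ d i, N * t ≤ ∑ g, w g * acceptanceGap g d i := by
    intro d i
    simp only [acceptanceGap, Finset.mul_sum]
    rw [Finset.sum_comm]
    refine le_trans (le_of_eq ?_) (Finset.sum_le_sum fun y _ => hgap _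
      (plantedInput_univ_mem d i y) _ (plantedInput_empty_mem d i y))
    rw [Finset.sum_const, Finset.card_univ, nsmul_eq_mul]
  -- Second moment versus mean, via the tangent line of the square at `N * t`.
  have hsq : ∀ d i, (N * t) ^ 2 ≤ ∑ g, w g * acceptanceGap g d i ^ 2 := by
    intro d i
    have h1 : ∑ g, w g * (2 * (N * t) * acceptanceGap g d i - (N * t) ^ 2) ≤
        ∑ g, w g * acceptanceGap g d i ^ 2 :=
      Finset.sum_le_sum fun g _ => mul_le_mul_of_nonneg_left
        (by nlinarith [sq_nonneg (acceptanceGap g d i - N * t)]) (hw0 g)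
    have h2 : ∑ g, w g * (2 * (N * t) * acceptanceGap g d i - (N * t) ^ 2) =
        2 * (N * t) * ∑ g, w g * acceptanceGap g d i - (N * t) ^ 2 * ∑ g, w g := by
      rw [Finset.mul_sum, Finset.mul_sum, ← Finset.sum_sub_distrib]
      exact Finset.sum_congr rfl fun g _ => by ring
    rw [h2, hw1] at h1
    have h3 := mul_le_mul_of_nonneg_left (hmean d i) (by positivity : 0 ≤ 2 * (N * t))
    nlinarith
  -- Functions of positive weight are computed by a protocol in the support; the others contribute
  -- zero.
  have hupper : ∀ g, w g * ∑ d, ∑ i, acceptanceGap g d i ^ 2 ≤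
      w g * (16 * Real.exp 2 * Real.log 2 * (k * C) * (M * N ^ 2)) := by
    intro g
    rcases (hw0 g).eq_or_lt with h | h
    · rw [← h, zero_mul, zero_mul]
    · have hg : g ∈ ν.support := by
        rw [PMF.mem_support_iff]
        intro h0
        simp [hw, h0] at h
      rw [hν, PMF.mem_support_map_iff] at hg
      obtain ⟨π, hπ, rfl⟩ := hg
      exact mul_le_mul_of_nonneg_left (sum_sq_acceptanceGap_le π (hC π hπ)) h.le
  have hfinal : M * (n * (N * t) ^ 2) ≤
      16 * Real.exp 2 * Real.log 2 * (k * C) * (M * N ^ 2) := by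
    calc M * (n * (N * t) ^ 2) = ∑ _d : Fin n → Fin k, ∑ _i : Fin n, (N * t) ^ 2 := by
          simp [hMdef]
      _ ≤ ∑ d, ∑ i, ∑ g, w g * acceptanceGap g d i ^ 2 :=
          Finset.sum_le_sum fun d _ => Finset.sum_le_sum fun i _ => hsq d i
      _ = ∑ g, w g * ∑ d, ∑ i, acceptanceGap g d i ^ 2 := by
          simp only [Finset.mul_sum]
          rw [Finset.sum_comm_cycle]
      _ ≤ ∑ g, w g * (16 * Real.exp 2 * Real.log 2 * (k * C) * (M * N ^ 2)) :=
          Finset.sum_le_sum fun g _ => hupper g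
      _ = _ := by rw [← Finset.sum_mul, hw1, one_mul]
  have hMN : 0 < M * N ^ 2 := by positivity
  refine le_of_mul_le_mul_right (le_trans (le_of_eq ?_) hfinal) hMN
  ring

end LowerBound

theorem theorem2 (ε : ℝ) (hε0 : 0 ≤ ε) (hε : ε < 1 / 2) :
    ∃ c : ℝ, 0 < c ∧ ∀ k n : ℕ, 2 ≤ k → 1 ≤ n →
      c * ((n : ℝ) / (k : ℝ)) ≤ (randomizedCC (udisjNo k n) (udisjYes k n) ε : ℝ) := by
  have hlog : 0 < Real.log 2 := Real.log_pos (by norm_num)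
  have hK : 0 < 16 * Real.exp 2 * Real.log 2 := by positivity
  have ht : 0 < 1 - 2 * ε := by linarith
  refine ⟨(1 - 2 * ε) ^ 2 / (16 * Real.exp 2 * Real.log 2), by positivity, fun k n hk _ => ?_⟩
  -- Nonemptiness matters: `sInf ∅ = 0` on `ℕ`. The infimum is attained, giving an optimal `μ`.
  obtain ⟨μ, hC, hμ⟩ := Nat.sInf_mem (achievableCosts_udisj_nonempty (k := k) n hk hε0)
  have h := hμ.le_cost (by omega) hε hC
  have hk0 : (0 : ℝ) < k := by exact_mod_cast (by omega : 0 < k)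
  rw [div_mul_div_comm, div_le_iff₀ (by positivity)]
  refine h.trans_eq ?_
  rw [randomizedCC]
  ring
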